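/- Let $q$ be a prime power, let $m$ and $k$ be positive integers with $1<k<\sigma_0(m)$, where $\sigma_0(m)$ is the number of positive divisors of $m$, and let $d_1<\dots<d_k<m$ be divisors of $m$ such that $d_i\nmid d_j$ for all $1\le i<j\le k$. Regard all the fields $\mathbb F_{q^d}$, $d\mid m$, as subfields of $\mathbb F_{q^m}$, and for $d\mid n\mid m$ and $\alpha\in\mathbb F_{q^n}$ put $\mathrm{Tr}_{n/d}(\alpha)=\sum_{i=0}^{n/d-1}\alpha^{q^{id}}$. Let $a_i\in\mathbb F_{q^{d_i}}$ $(1\le i\le k)$ be such that * (admissibility) $\mathrm{Tr}_{d_i/\gcd(d_i,d_j)}(a_i)=\mathrm{Tr}_{d_j/\gcd(d_i,d_j)}(a_j)$ for all $1\le i<j\le k$, and * (normality) each $a_i$ is normal over $\mathbb F_q$, i.e. $a_i,a_i^{q},\dots,a_i^{q^{d_i-1}}$ is a basis of $\mathbb F_{q^{d_i}}$ over $\mathbb F_q$. Put $D=d_1+\dots+d_k$ and $$\lambda(\mathbf d)=d_1+\cdots+d_k+\sum_{r=2}^{k}(-1)^{r+1}\sum_{1\le l_1<\dots<l_r\le k}\gcd(d_{l_1},\dots,d_{l_r}).$$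 Let $W(q^m-1)$ be the number of square-free positive divisors of the integer $q^m-1$, and let $W(x^m-1)$ be the number of square-free monic divisors of $x^m-1$ in $\mathbb F_q[x]$. If $$q^{m/2-\lambda(\mathbf d)-D}\ \ge\ W(q^m-1)\cdot W(x^m-1),$$ then there exists $\alpha\in\mathbb F_{q^m}$ which is primitive (it generates the multiplicative group $\mathbb F_{q^m}^*$) and normal over $\mathbb F_q$ (its conjugates $\alpha,\alpha^q,\dots,\alpha^{q^{m-1}}$ form a basis of $\mathbb F_{q^m}$ over $\mathbb F_q$), and which satisfies $\mathrm{Tr}_{m/d_i}(\alpha)=a_i$ for every $1\le i\le k$. -/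

import Mathlib

open scoped BigOperators Polynomial

namespace PrescribedTraces

/-- Inside an extension `K` of the finite field `F` with `q = Nat.card F` elements, the subfield
of all `x` with `x ^ (q ^ d) = x`. If `K` has degree `m` over `F` and `d` divides `m`, it is the
intermediate field with `q ^ d` elements. -/
def subfieldOfDegree (F K : Type*) [Field F] [Finite F] [Field K] [Algebra F K] (d : ℕ) :
    IntermediateField F K where
  carrier := {x | x ^ (Nat.card F ^ d) = x}
  mul_mem' := by
    intro x y hx hy
    simp only [Set.mem_ofPred_eq] at *
    rw [mul_pow, hx, hy]
  add_mem' := by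
    intro x y hx hy
    simp only [Set.mem_ofPred_eq] at *
    have := Fintype.ofFinite F
    obtain ⟨p, hp⟩ := CharP.exists F
    have hpK : CharP K p := (Algebra.charP_iff F K p).1 hp
    obtain ⟨n, hprime, hn⟩ := FiniteField.card F p
    have : Fact p.Prime := ⟨hprime⟩
    rw [Nat.card_eq_fintype_card, hn, ← pow_mul] at hx hy ⊢
    rw [add_pow_char_pow, hx, hy]
  algebraMap_mem' := by
    intro r
    simp only [Set.mem_ofPred_eq]
    have := Fintype.ofFinite F
    rw [← map_pow, Nat.card_eq_fintype_card, FiniteField.pow_card_pow]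
  inv_mem' := by
    intro x hx
    simp only [Set.mem_ofPred_eq] at *
    rw [inv_pow, hx]

/-- The trace from the field with `q ^ n` elements to the one with `q ^ d` elements (`d ∣ n`),
`q = Nat.card F`, as a sum of conjugates computed in an ambient field `K`. -/
noncomputable def tr (F : Type*) {K : Type*} [Field K] (n d : ℕ) (α : K) : K :=
  ∑ i ∈ Finset.range (n / d), α ^ (Nat.card F ^ (i * d))

/-- `α` is normal over `F`: with `q = Nat.card F` and `n = [L : F]`, the conjugates
`α, α ^ q, …, α ^ (q ^ (n - 1))` form a basis of `L` over `F`. -/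
def IsNormalElement (F : Type*) {L : Type*} [Field F] [Field L] [Algebra F L] (α : L) : Prop :=
  LinearIndependent F (fun i : Fin (Module.finrank F L) => α ^ (Nat.card F ^ (i : ℕ))) ∧
  Submodule.span F
    (Set.range (fun i : Fin (Module.finrank F L) => α ^ (Nat.card F ^ (i : ℕ)))) = ⊤

/-- `α` is primitive: it generates the multiplicative group of `K`. -/
def IsPrimitiveElement {K : Type*} [Field K] (α : K) : Prop :=
  ∃ u : Kˣ, (u : K) = α ∧ Subgroup.zpowers u = ⊤

/-- The `k`-tuples `d₁ < ⋯ < d_k < m` of divisors of `m`, none of which divides a later one. -/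
def divisorTuples (k m : ℕ) : Set (Fin k → ℕ) :=
  {d | StrictMono d ∧ (∀ i, d i ∣ m) ∧ (∀ i, d i < m) ∧ ∀ i j, i < j → ¬ d i ∣ d j}

/-- `d₁ + ⋯ + d_k + ∑_{r = 2}^{k} (-1) ^ (r + 1) ∑_{l₁ < ⋯ < l_r} gcd (d_{l₁}, …, d_{l_r})`. -/
def lam {k : ℕ} (d : Fin k → ℕ) : ℤ :=
  (∑ i, (d i : ℤ)) + ∑ r ∈ Finset.Icc 2 k,
    (-1 : ℤ) ^ (r + 1) * ∑ S ∈ Finset.powersetCard r (Finset.univ : Finset (Fin k)),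
      ((S.gcd d : ℕ) : ℤ)

/-- The tuple `a`, with `a i` in the field with `q ^ (d i)` elements, is `d`-admissible. -/
def IsAdmissible {F K : Type*} [Field F] [Finite F] [Field K] [Algebra F K] {k : ℕ}
    (d : Fin k → ℕ) (a : ∀ i, subfieldOfDegree F K (d i)) : Prop :=
  ∀ i j, i < j →
    tr F (d i) (Nat.gcd (d i) (d j)) (a i : K) = tr F (d j) (Nat.gcd (d i) (d j)) (a j : K)

/-- The number of squarefree divisors of a natural number. -/
noncomputable def natW (n : ℕ) : ℕ := {t : ℕ | t ∣ n ∧ Squarefree t}.ncard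

/-- The number of (monic) squarefree divisors of a polynomial over `F`. -/
noncomputable def polyW {F : Type*} [Field F] (f : F[X]) : ℕ :=
  {g : F[X] | g.Monic ∧ Squarefree g ∧ g ∣ f}.ncard

end PrescribedTraces

/-! Let `X` act on `K` as the Frobenius, making `K` an `F[X]`-module with annihilator generated by
`X ^ m - 1`. Then `α` is normal as soon as `(X ^ m - 1) / P` does not kill `α`, for every monic
irreducible `P ∣ X ^ m - 1`. If `P ∣ X ^ d i - 1` for some `i`, this follows from the trace
condition and the normality of `a i` (`frobAction_ne_zero_of_dvd_X_pow_sub_one`). Let `S` be the set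
of the other `P`: these are coprime to every `X ^ d i - 1`, so their conditions are exactly
independent of the traces and of each other (`sum_mul_siftedIndicator`). With `N` elements having
the prescribed traces, `N * κ` of them also satisfy the conditions from `S`, where `κ` is the
product of the densities. Primitivity is detected by a second sieve, on `Kˣ`, with density `θ`.
Multiplication by the indicator of a trace fibre has Fourier norm at most 1, and each sieve
condition costs twice its density. With the Gauss sum bound, the main term `θ * κ * N` is off by at
most `2 ^ ω * θ * 2 ^ |S| * κ * √|K|`, where `ω` is the number of primes dividing `|Kˣ|`. The
densities cancel, so `2 ^ ω * 2 ^ |S| * √|K| < N` suffices (`exists_generator_of_lt_card_tr_eq`).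
Finally `N ≥ q ^ (m - λ)`, because `λ` is the degree of the least common multiple of the `X ^ d i -
1` (`exists_lcm_X_pow_sub_one`, `pow_le_card_tr_eq`). -/

namespace PrescribedTraces

/-! ### Multiplier norms for additive characters. -/

section Fourier

variable {G : Type*} [AddCommGroup G] [Fintype G]

/-- Multiplication by `f` has norm at most `C` with respect to the norm
`g ↦ sup_ψ ‖∑ x, g x * ψ x‖`, the supremum being over all characters of `G`. -/
def FourierNormLE (f : G → ℂ) (C : ℝ) : Prop :=
  ∀ (g : G → ℂ) (M : ℝ), (∀ ψ : AddChar G ℂ, ‖∑ x, g x * ψ x‖ ≤ M) →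
    ∀ ψ : AddChar G ℂ, ‖∑ x, f x * g x * ψ x‖ ≤ C * M

theorem FourierNormLE.mul {f₁ f₂ : G → ℂ} {C₁ C₂ : ℝ} (h₁ : FourierNormLE f₁ C₁)
    (h₂ : FourierNormLE f₂ C₂) : FourierNormLE (fun x => f₁ x * f₂ x) (C₁ * C₂) := by
  intro g M hg ψ
  have := h₁ (fun x => f₂ x * g x) (C₂ * M) (h₂ g M hg) ψ
  simpa only [mul_assoc] using this

theorem fourierNormLE_one : FourierNormLE (fun _ : G => 1) 1 := by
  intro g M hg ψ
  simpa using hg ψ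

theorem FourierNormLE.prod {ι : Type*} (s : Finset ι) {f : ι → G → ℂ} {C : ι → ℝ}
    (h : ∀ i ∈ s, FourierNormLE (f i) (C i)) :
    FourierNormLE (fun x => ∏ i ∈ s, f i x) (∏ i ∈ s, C i) := by
  classical
  induction s using Finset.induction_on with
  | empty => simpa using fourierNormLE_one
  | insert a s ha ih =>
    simp only [Finset.prod_insert ha]
    exact (h a (Finset.mem_insert_self a s)).mul
      (ih fun i hi => h i (Finset.mem_insert_of_mem hi))

/-- Multiplication by a character only permutes the Fourier coefficients of `g`, so the `ℓ¹` norm of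
the coefficients of `f` bounds its multiplier norm. -/
theorem fourierNormLE_of_sum {ι : Type*} (s : Finset ι) (c : ι → ℂ) (χ : ι → AddChar G ℂ)
    (f : G → ℂ) (C : ℝ) (hf : ∀ x, f x = ∑ i ∈ s, c i * χ i x) (hC : ∑ i ∈ s, ‖c i‖ ≤ C) :
    FourierNormLE f C := by
  intro g M hg ψ
  have hM : 0 ≤ M := (norm_nonneg _).trans (hg ψ)
  have : ∑ x, f x * g x * ψ x = ∑ i ∈ s, c i * ∑ x, g x * (χ i * ψ) x := by
    simp only [hf, Finset.sum_mul, Finset.mul_sum, AddChar.mul_apply]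
    rw [Finset.sum_comm]
    refine Finset.sum_congr rfl fun i _ => Finset.sum_congr rfl fun x _ => by ring
  rw [this]
  calc _ ≤ ∑ i ∈ s, ‖c i * ∑ x, g x * (χ i * ψ) x‖ := norm_sum_le _ _
    _ ≤ ∑ i ∈ s, ‖c i‖ * M := by
        refine Finset.sum_le_sum fun i _ => ?_
        rw [norm_mul]
        exact mul_le_mul_of_nonneg_left (hg _) (norm_nonneg _)
    _ = (∑ i ∈ s, ‖c i‖) * M := (Finset.sum_mul _ _ _).symm
    _ ≤ C * M := mul_le_mul_of_nonneg_right hC hM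

open Classical in
theorem fourierNormLE_fiber {V : Type*} [AddCommGroup V] [Finite V] (φ : G →+ V) (v : V) :
    FourierNormLE (fun x => if φ x = v then 1 else 0) 1 := by
  have := Fintype.ofFinite V
  refine fourierNormLE_of_sum (Finset.univ : Finset (AddChar V ℂ))
    (fun ψ => (Fintype.card V : ℂ)⁻¹ * ψ (-v)) (fun ψ => ψ.compAddMonoidHom φ) _ _ ?_ ?_
  · intro x
    have h := AddChar.sum_apply_eq_ite (φ x - v)
    have h2 : ∀ ψ : AddChar V ℂ, (Fintype.card V : ℂ)⁻¹ * ψ (-v) * (ψ.compAddMonoidHom φ) x =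
        (Fintype.card V : ℂ)⁻¹ * ψ (φ x - v) := by
      intro ψ
      rw [AddChar.compAddMonoidHom_apply, sub_eq_add_neg, AddChar.map_add_eq_mul]
      ring
    simp only [h2, ← Finset.mul_sum, h, sub_eq_zero]
    split_ifs <;> simp
  · simp [AddChar.norm_apply, AddChar.card_eq]

open Classical in
-- With `n` the index of `N`, the trivial coefficient is `1 - 1 / n` and the other `n - 1` are `-1 /
-- n`, in total `2 * (1 - 1 / n)`. Keeping the density `1 - 1 / n` in the bound lets it cancel
-- against the main term later.
theorem fourierNormLE_compl (N : AddSubgroup G) :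
    FourierNormLE (fun x => if x ∈ N then 0 else 1)
      (2 * (1 - (Nat.card N : ℝ) / Fintype.card G)) := by
  have := Fintype.ofFinite (G ⧸ N)
  have hcard : (Nat.card N : ℝ) / Fintype.card G = (Fintype.card (G ⧸ N) : ℝ)⁻¹ := by
    have h := N.card_eq_card_quotient_mul_card_addSubgroup
    have h0 : (Nat.card N : ℝ) ≠ 0 := by exact_mod_cast Nat.card_pos.ne'
    rw [← Nat.card_eq_fintype_card (α := G), h, ← Nat.card_eq_fintype_card]
    push_cast
    field_simp
  set n := Fintype.card (G ⧸ N) with hn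
  have hn0 : (n : ℂ) ≠ 0 := by exact_mod_cast Fintype.card_ne_zero
  have hn1 : (1 : ℝ) ≤ n := by exact_mod_cast Fintype.card_pos
  refine fourierNormLE_of_sum (Finset.univ : Finset (AddChar (G ⧸ N) ℂ))
    (fun ψ => (if ψ = 0 then 1 else 0) - (n : ℂ)⁻¹)
    (fun ψ => ψ.compAddMonoidHom (QuotientAddGroup.mk' N)) _ _ ?_ ?_
  · intro x
    have h := AddChar.sum_apply_eq_ite (QuotientAddGroup.mk' N x)
    simp only [sub_mul, Finset.sum_sub_distrib, AddChar.compAddMonoidHom_apply, ← Finset.mul_sum,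
      ite_mul, one_mul, zero_mul, Finset.sum_ite_eq', Finset.mem_univ, if_true, AddChar.zero_apply]
    rw [h, QuotientAddGroup.mk'_apply]
    simp only [QuotientAddGroup.eq_zero_iff]
    split_ifs
    · rw [inv_mul_cancel₀ hn0, sub_self]
    · simp
  · rw [hcard, ← Finset.add_sum_erase _ _ (Finset.mem_univ (0 : AddChar (G ⧸ N) ℂ))]
    have h1 : ∑ ψ ∈ Finset.univ.erase (0 : AddChar (G ⧸ N) ℂ),
        ‖(if ψ = 0 then (1 : ℂ) else 0) - (n : ℂ)⁻¹‖ = (n - 1) * (n : ℝ)⁻¹ := by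
      rw [Finset.sum_congr rfl (g := fun _ => (n : ℝ)⁻¹)]
      · rw [Finset.sum_const, Finset.card_erase_of_mem (Finset.mem_univ _), Finset.card_univ,
          AddChar.card_eq, nsmul_eq_mul, Nat.cast_pred Fintype.card_pos]
      · intro ψ hψ
        simp [Finset.ne_of_mem_erase hψ]
    have h2 : ‖(if (0 : AddChar (G ⧸ N) ℂ) = 0 then (1 : ℂ) else 0) - (n : ℂ)⁻¹‖
        = 1 - (n : ℝ)⁻¹ := by
      have : (1 : ℂ) - (n : ℂ)⁻¹ = ((1 - (n : ℝ)⁻¹ : ℝ) : ℂ) := by push_cast; rfl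
      rw [if_pos rfl, this, Complex.norm_of_nonneg]
      exact sub_nonneg.2 (inv_le_one_of_one_le₀ hn1)
    rw [h1, h2]
    apply le_of_eq
    field_simp
    ring

end Fourier

/-! ### Sieve conditions with coprime moduli are independent. -/

section Independence

variable {R G : Type*} [CommRing R] [AddCommGroup G] [Module R G]

variable (G) in
/-- The elements of `G` annihilated by `e`. -/
def annihilatedBy (e : R) : AddSubgroup G := (DistribSMul.toAddMonoidHom G e).ker

theorem mem_annihilatedBy {e : R} {x : G} : x ∈ annihilatedBy G e ↔ e • x = 0 := Iff.rfl

open Classical in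
/-- The indicator function of the elements annihilated by no `e i`. -/
noncomputable def siftedIndicator {ι : Type*} (S : Finset ι) (e : ι → R) (x : G) : ℂ :=
  ∏ i ∈ S, if x ∈ annihilatedBy G (e i) then 0 else 1

theorem siftedIndicator_eq_zero_of {ι : Type*} {S : Finset ι} {e : ι → R} {x : G} {i : ι}
    (hi : i ∈ S) (hx : e i • x = 0) : siftedIndicator S e x = 0 :=
  Finset.prod_eq_zero hi (if_pos hx)

variable [Fintype G]

/-- Since `r • G + s • G = G`, invariance under the two summands makes `f` and `g` independent. With
`a * r + b * s = 1`, translation by `r • a • t` leaves `f` alone and moves the argument of `g`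
effectively by `t`; averaging over `t` decouples them. -/
theorem card_mul_sum_mul_of_isCoprime {r s : R} (hrs : IsCoprime r s) {f g : G → ℂ}
    (hf : ∀ x y, f (x + r • y) = f x) (hg : ∀ x y, g (x + s • y) = g x) :
    (Fintype.card G : ℂ) * ∑ x, f x * g x = (∑ x, f x) * ∑ x, g x := by
  obtain ⟨a, b, hab⟩ := hrs
  have key : ∀ x t, f x * g (x + t) = f (x + r • a • t) * g (x + r • a • t) := by
    intro x t
    rw [hf, ← hg (x + r • a • t) (b • t)]
    have : x + r • a • t + s • b • t = x + t := by
      rw [add_assoc, smul_smul, smul_smul, ← add_smul, mul_comm r, mul_comm s, hab, one_smul]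
    rw [this]
  calc _ = ∑ t : G, ∑ x, f (x + r • a • t) * g (x + r • a • t) := by
        have : ∀ t : G, ∑ x, f (x + r • a • t) * g (x + r • a • t) = ∑ x, f x * g x := fun t =>
          Fintype.sum_equiv (Equiv.addRight (r • a • t)) _ _ fun x => rfl
        simp [this]
    _ = ∑ x, ∑ t, f x * g (x + t) := by
        rw [Finset.sum_comm]
        simp only [key]
    _ = ∑ x, f x * ∑ y, g y := by
        refine Finset.sum_congr rfl fun x _ => ?_
        rw [← Finset.mul_sum]
        congr 1
        exact Fintype.sum_equiv (Equiv.addLeft x) _ _ fun x => rfl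
    _ = _ := (Finset.sum_mul _ _ _).symm

variable (G) in
/-- The proportion of elements of `G` which are not annihilated by `e`. -/
noncomputable def survivingDensity (e : R) : ℝ :=
  1 - (Nat.card (annihilatedBy G e) : ℝ) / Fintype.card G

theorem fourierNormLE_siftedIndicator {ι : Type*} (S : Finset ι) (e : ι → R) :
    FourierNormLE (siftedIndicator S e : G → ℂ)
      (2 ^ S.card * ∏ i ∈ S, survivingDensity G (e i)) := by
  have := FourierNormLE.prod S fun i _ => fourierNormLE_compl (annihilatedBy G (e i))
  rwa [Finset.prod_mul_distrib, Finset.prod_const] at this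

theorem survivingDensity_pos {e : R} (h : ∃ x : G, e • x ≠ 0) : 0 < survivingDensity G e := by
  obtain ⟨x, hx⟩ := h
  have h1 : Nat.card (annihilatedBy G e) < Fintype.card G := by
    rw [← Nat.card_eq_fintype_card, ← AddSubgroup.card_top (G := G)]
    refine lt_of_le_of_ne (AddSubgroup.card_le_of_le le_top) fun h => hx ?_
    have := AddSubgroup.eq_of_le_of_card_ge (le_top : annihilatedBy G e ≤ ⊤) h.ge
    exact mem_annihilatedBy.1 (this ▸ AddSubgroup.mem_top x)
  have h2 : (0 : ℝ) < Fintype.card G := by exact_mod_cast Fintype.card_pos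
  rw [survivingDensity, sub_pos, div_lt_one h2]
  exact_mod_cast h1

open Classical in
theorem sum_not_annihilated (e : R) :
    ∑ x : G, (if x ∈ annihilatedBy G e then (0 : ℂ) else 1) =
      Fintype.card G * survivingDensity G e := by
  have h1 : ∀ x : G, (if x ∈ annihilatedBy G e then (0 : ℂ) else 1) =
      1 - if x ∈ annihilatedBy G e then 1 else 0 := by
    intro x
    split_ifs <;> simp
  have h2 : (Fintype.card G : ℂ) ≠ 0 := by exact_mod_cast Fintype.card_ne_zero
  simp only [h1, Finset.sum_sub_distrib, Finset.sum_const, Finset.card_univ, Finset.sum_boole,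
    survivingDensity, nsmul_eq_mul, mul_one]
  rw [Nat.card_eq_fintype_card, Fintype.card_subtype]
  push_cast
  field_simp

theorem sum_mul_siftedIndicator {ι : Type*} (S : Finset ι) (p e : ι → R)
    (hp : (S : Set ι).Pairwise fun i j => IsCoprime (p i) (p j))
    (hep : ∀ i ∈ S, ∀ x : G, e i • p i • x = 0) {r : R} (hr : ∀ i ∈ S, IsCoprime r (p i))
    {f : G → ℂ} (hf : ∀ x y, f (x + r • y) = f x) :
    ∑ x, f x * siftedIndicator S e x = (∑ x, f x) * ∏ i ∈ S, (survivingDensity G (e i) : ℂ) := by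
  classical
  induction S using Finset.induction_on generalizing r f with
  | empty => simp [siftedIndicator]
  | insert a s ha ih =>
    have hg : ∀ x y : G, (if x + p a • y ∈ annihilatedBy G (e a) then (0 : ℂ) else 1) =
        if x ∈ annihilatedBy G (e a) then 0 else 1 := by
      intro x y
      simp only [mem_annihilatedBy, smul_add, hep a (Finset.mem_insert_self _ _), add_zero]
    have h1 : ∀ x, f x * siftedIndicator (insert a s) e x =
        (f x * if x ∈ annihilatedBy G (e a) then (0 : ℂ) else 1) * siftedIndicator s e x := by
      intro x
      rw [siftedIndicator, Finset.prod_insert ha, ← mul_assoc]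
      rfl
    simp only [h1]
    -- The condition at `a` is absorbed into `f`; the product is still invariant, now under `r * p
    -- a`.
    rw [ih (r := r * p a)]
    · have h2 := card_mul_sum_mul_of_isCoprime (hr a (Finset.mem_insert_self _ _)) hf
        (g := fun x => if x ∈ annihilatedBy G (e a) then 0 else 1) hg
      have h3 : (Fintype.card G : ℂ) ≠ 0 := by exact_mod_cast Fintype.card_ne_zero
      rw [sum_not_annihilated] at h2
      rw [Finset.prod_insert ha, ← mul_assoc]
      congr 1
      apply mul_left_cancel₀ h3
      rw [h2]
      ring
    · exact hp.mono (by simp)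
    · exact fun i hi => hep i (Finset.mem_insert_of_mem hi)
    · intro i hi
      refine (hr i (Finset.mem_insert_of_mem hi)).mul_left ?_
      exact hp (by simp) (by simp [hi]) fun h => ha (h ▸ hi)
    · intro x y
      rw [mul_comm r, mul_smul, hg, ← mul_smul, mul_comm (p a), mul_smul, hf]

end Independence

/-! ### Generators of `Kˣ` and Gauss sums. -/

section Multiplicative

variable {K : Type*} [Field K]

theorem exists_mulChar (ψ : AddChar (Additive Kˣ) ℂ) :
    ∃ χ : MulChar K ℂ, ∀ u : Kˣ, χ u = ψ (Additive.ofMul u) := by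
  let f : Kˣ →* ℂ :=
    { toFun := fun u => ψ (Additive.ofMul u)
      map_one' := ψ.map_zero_eq_one
      map_mul' := fun a b => ψ.map_add_eq_mul _ _ }
  exact ⟨MulChar.ofUnitHom f.toHomUnits, fun u => MulChar.ofUnitHom_coe _ _⟩

section Generators

variable [Fintype Kˣ]

/-- The indicator function of the generators of `Kˣ`. -/
noncomputable def generatorIndicator (K : Type*) [Field K] [Fintype Kˣ] : Additive Kˣ → ℂ :=
  siftedIndicator (Fintype.card Kˣ).primeFactors fun p => ((Fintype.card Kˣ / p : ℕ) : ℤ)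

theorem zpowers_eq_top_of_generatorIndicator_ne_zero {u : Kˣ}
    (h : generatorIndicator K (Additive.ofMul u) ≠ 0) : Subgroup.zpowers u = ⊤ := by
  have h1 : orderOf u = Fintype.card Kˣ := by
    refine orderOf_eq_of_pow_and_pow_div_prime Fintype.card_pos pow_card_eq_one ?_
    intro p hp hpd hu
    refine h (siftedIndicator_eq_zero_of (Nat.mem_primeFactors.2 ⟨hp, hpd, Fintype.card_ne_zero⟩) ?_)
    rw [natCast_zsmul, ← ofMul_pow, hu, ofMul_one]
  rw [← Nat.card_eq_fintype_card] at h1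
  exact Subgroup.eq_top_of_card_eq _ (by rw [Nat.card_zpowers, h1])

/-- The proportion of generators in `Kˣ`. -/
noncomputable def generatorDensity (K : Type*) [Field K] [Fintype Kˣ] : ℝ :=
  ∏ p ∈ (Fintype.card Kˣ).primeFactors,
    survivingDensity (Additive Kˣ) ((Fintype.card Kˣ / p : ℕ) : ℤ)

theorem generatorDensity_pos : 0 < generatorDensity K := by
  refine Finset.prod_pos fun p hp => survivingDensity_pos ?_
  obtain ⟨g, hg⟩ := IsCyclic.exists_generator (α := Kˣ)
  have ho : orderOf g = Fintype.card Kˣ := orderOf_eq_card_of_forall_mem_zpowers hg |>.trans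
    Nat.card_eq_fintype_card
  refine ⟨Additive.ofMul g, fun h => ?_⟩
  rw [natCast_zsmul, ← ofMul_pow, ofMul_eq_zero] at h
  have hpp := Nat.prime_of_mem_primeFactors hp
  have := Nat.le_of_dvd (Nat.div_pos (Nat.le_of_dvd Fintype.card_pos
    (Nat.dvd_of_mem_primeFactors hp)) hpp.pos) (orderOf_dvd_of_pow_eq_one h)
  rw [ho] at this
  exact absurd this (Nat.div_lt_self Fintype.card_pos hpp.one_lt).not_ge

theorem sum_generatorIndicator :
    ∑ u, generatorIndicator K u = Fintype.card Kˣ * generatorDensity K := by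
  have h := sum_mul_siftedIndicator (G := Additive Kˣ) (Fintype.card Kˣ).primeFactors
    (fun p => (p : ℤ)) (fun p => ((Fintype.card Kˣ / p : ℕ) : ℤ)) ?_ ?_ (r := 1) ?_
    (f := fun _ => 1) ?_
  · simp only [one_mul, Finset.sum_const, Finset.card_univ, nsmul_eq_mul, mul_one] at h
    rw [generatorDensity, Complex.ofReal_prod]
    exact h.trans (by rw [Fintype.card_additive])
  · intro p hp p' hp' hne
    exact Nat.isCoprime_iff_coprime.2 ((Nat.coprime_primes (Nat.prime_of_mem_primeFactors hp)
      (Nat.prime_of_mem_primeFactors hp')).2 hne)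
  · intro p hp x
    rw [smul_smul, ← Nat.cast_mul, Nat.div_mul_cancel (Nat.dvd_of_mem_primeFactors hp),
      natCast_zsmul]
    exact pow_card_eq_one (x := Additive.toMul x)
  · exact fun p _ => isCoprime_one_left
  · exact fun _ _ => rfl

end Generators

variable [Fintype K]

theorem norm_gaussSum_le {χ : MulChar K ℂ} (hχ : χ ≠ 1) (ψ : AddChar K ℂ) :
    ‖∑ x, χ x * ψ x‖ ≤ √(Fintype.card K) := by
  change ‖gaussSum χ ψ‖ ≤ _
  -- The multiplier norm ranges over all additive characters, including the trivial one, where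
  -- orthogonality gives 0.
  by_cases hψ : ψ = 1
  · rw [hψ, gaussSum_one_right hχ, norm_zero]
    exact Real.sqrt_nonneg _
  · have h := gaussSum_mul_gaussSum_eq_card hχ (AddChar.IsPrimitive.of_ne_one hψ)
    rw [← star_gaussSum_eq] at h
    have h2 := congrArg norm h
    rw [norm_mul, norm_star, Complex.norm_natCast] at h2
    exact ((Real.sqrt_eq_iff_mul_self_eq (Nat.cast_nonneg _) (norm_nonneg _)).2 h2.symm).ge

theorem FourierNormLE.norm_sum_mul_mulChar_le {ν : K → ℂ} {C : ℝ} (h : FourierNormLE ν C)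
    {χ : MulChar K ℂ} (hχ : χ ≠ 1) : ‖∑ x, ν x * χ x‖ ≤ C * √(Fintype.card K) := by
  simpa using h χ _ (norm_gaussSum_le hχ) 1

variable [Fintype Kˣ]

theorem sum_units_eq_sum {M : Type*} [AddCommMonoid M] {f : K → M} (h : f 0 = 0) :
    ∑ u : Kˣ, f u = ∑ x, f x := by
  classical
  rw [← Finset.sum_erase Finset.univ h]
  refine Finset.sum_bij (fun u _ => (u : K)) (by simp) (fun _ _ _ _ h => Units.ext h) ?_
    fun _ _ => rfl
  intro x hx
  exact ⟨Units.mk0 x (Finset.ne_of_mem_erase hx), Finset.mem_univ _, rfl⟩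

theorem norm_sum_generatorIndicator_mul_sub_le {ν : K → ℂ} {C : ℝ} (h : FourierNormLE ν C)
    (hC : 0 ≤ C) (h0 : ν 0 = 0) :
    ‖(∑ u : Kˣ, generatorIndicator K (Additive.ofMul u) * ν u) - generatorDensity K * ∑ x, ν x‖ ≤
      2 ^ (Fintype.card Kˣ).primeFactors.card * generatorDensity K * (C * √(Fintype.card K)) := by
  have hQ : (Fintype.card Kˣ : ℂ) ≠ 0 := by exact_mod_cast Fintype.card_ne_zero
  -- Subtracting this mean kills the coefficient at the trivial multiplicative character, and its
  -- weight against the generators is exactly the main term.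
  set c : ℂ := (∑ x, ν x) / Fintype.card Kˣ with hc
  have key := fourierNormLE_siftedIndicator (G := Additive Kˣ) (Fintype.card Kˣ).primeFactors
    (fun p => ((Fintype.card Kˣ / p : ℕ) : ℤ)) (fun u => ν (Additive.toMul u : Kˣ) - c)
    (C * √(Fintype.card K)) ?_ 1
  · have h1 : ∑ u : Additive Kˣ, generatorIndicator K u * (ν (Additive.toMul u : Kˣ) - c) =
        (∑ u : Kˣ, generatorIndicator K (Additive.ofMul u) * ν u) -
          generatorDensity K * ∑ x, ν x := by
      simp only [mul_sub, Finset.sum_sub_distrib, ← Finset.sum_mul, sum_generatorIndicator]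
      congr 1
      · exact Fintype.sum_equiv Additive.toMul _ _ fun _ => rfl
      · rw [hc]
        field_simp
    rw [← h1]
    simp only [AddChar.one_apply, mul_one] at key
    exact key
  · intro ψ
    obtain ⟨χ, hχ⟩ := exists_mulChar ψ
    have h2 : ∑ u : Additive Kˣ, (ν (Additive.toMul u : Kˣ) - c) * ψ u =
        ∑ x, ν x * χ x - c * ∑ x, χ x := by
      rw [← sum_units_eq_sum (f := fun x => ν x * χ x) (by simp [h0]),
        ← sum_units_eq_sum (f := χ) χ.map_zero]
      simp only [hχ, Finset.mul_sum, ← Finset.sum_sub_distrib, sub_mul]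
      exact Fintype.sum_equiv Additive.toMul _ _ fun _ => rfl
    rw [h2]
    by_cases h1 : χ = 1
    · have h3 : ∑ x, ν x * χ x = ∑ x, ν x := by
        refine Finset.sum_congr rfl fun x _ => ?_
        by_cases hx : x = 0
        · simp [hx, h0]
        · rw [h1, MulChar.one_apply (isUnit_iff_ne_zero.2 hx), mul_one]
      have h4 : ∑ x, χ x = Fintype.card Kˣ := by
        classical
        rw [h1, MulChar.sum_one_eq_card_units]
        congr!
      rw [h3, h4, hc, div_mul_cancel₀ _ hQ, sub_self, norm_zero]
      positivity
    · rw [MulChar.sum_eq_zero_of_ne_one h1, mul_zero, sub_zero]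
      exact h.norm_sum_mul_mulChar_le h1

/-- The generator density is a positive factor of both main term and error, so no lower bound for it
is needed. -/
theorem exists_generator_of_fourierNormLE {ν : K → ℂ} {C : ℝ} (h : FourierNormLE ν C)
    (hC : 0 ≤ C) (h0 : ν 0 = 0)
    (hlt : 2 ^ (Fintype.card Kˣ).primeFactors.card * (C * √(Fintype.card K)) < ‖∑ x, ν x‖) :
    ∃ u : Kˣ, Subgroup.zpowers u = ⊤ ∧ ν u ≠ 0 := by
  by_contra! hcon
  have hz : ∑ u : Kˣ, generatorIndicator K (Additive.ofMul u) * ν u = 0 := by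
    refine Finset.sum_eq_zero fun u _ => ?_
    by_cases hu : generatorIndicator K (Additive.ofMul u) = 0
    · rw [hu, zero_mul]
    · rw [hcon u (zpowers_eq_top_of_generatorIndicator_ne_zero hu), mul_zero]
  have hle := norm_sum_generatorIndicator_mul_sub_le h hC h0
  have hθ := generatorDensity_pos (K := K)
  rw [hz, zero_sub, norm_neg, norm_mul, Complex.norm_of_nonneg hθ.le, mul_right_comm, mul_comm]
    at hle
  exact hlt.not_ge (le_of_mul_le_mul_right hle hθ)

end Multiplicative

/-! ### Distributivity of gcd over lcm, and simultaneous congruences. -/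

section GCD

/-- Write `a`, `b` as `gcd a b` times `a'`, `b'` with `a'`, `b'` coprime, so that the lcm is `a * b'
= b * a'`. Then `e` divides both `n * b'` and `n * a'`, hence their gcd, which is associated to `n`.
-/
theorem dvd_lcm_gcd_of_dvd_lcm {α : Type*} [CommMonoidWithZero α] [GCDMonoid α] {a b e : α}
    (h : e ∣ lcm a b) : e ∣ lcm (gcd a e) (gcd b e) := by
  by_cases hg : gcd a b = 0
  · obtain ⟨rfl, rfl⟩ := (gcd_eq_zero_iff a b).1 hg
    exact (dvd_gcd (dvd_zero e) dvd_rfl).trans (dvd_lcm_left _ _)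
  obtain ⟨a', b', ha, hb, hu⟩ := extract_gcd a b
  set n := lcm (gcd a e) (gcd b e)
  have hlcm : Associated (lcm a b) (a * b') := by
    refine Associated.of_mul_left ((gcd_mul_lcm a b).trans ?_) (Associated.refl (gcd a b)) hg
    conv_lhs => rw [hb]
    rw [mul_left_comm]
  have hcomm : a * b' = b * a' := by
    conv_lhs => rw [ha]
    conv_rhs => rw [hb]
    rw [mul_right_comm]
  have h1 : e ∣ a * b' := h.trans hlcm.dvd
  have hb' : e ∣ n * b' :=
    ((dvd_gcd h1 (dvd_mul_right e b')).trans (gcd_mul_right' b' a e).dvd).trans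
      (mul_dvd_mul_right (dvd_lcm_left _ _) _)
  have ha' : e ∣ n * a' :=
    ((dvd_gcd (hcomm ▸ h1) (dvd_mul_right e a')).trans (gcd_mul_right' a' b e).dvd).trans
      (mul_dvd_mul_right (dvd_lcm_right _ _) _)
  refine ((dvd_gcd ha' hb').trans (gcd_mul_left' n a' b').dvd).trans ?_
  exact (associated_mul_unit_left n _ hu).dvd

theorem dvd_finset_lcm_gcd_of_dvd_lcm {ι α : Type*} [CommMonoidWithZero α]
    [NormalizedGCDMonoid α] (s : Finset ι) (G : ι → α) {e : α} (h : e ∣ s.lcm G) :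
    e ∣ s.lcm fun i => gcd (G i) e := by
  classical
  induction s using Finset.induction_on generalizing e with
  | empty => simpa using h
  | insert a s ha ih =>
    rw [Finset.lcm_insert] at h ⊢
    refine (dvd_lcm_gcd_of_dvd_lcm h).trans (lcm_dvd_lcm dvd_rfl ?_)
    refine (ih (gcd_dvd_left _ e)).trans (Finset.lcm_mono_fun fun i _ => ?_)
    exact gcd_dvd_gcd dvd_rfl (gcd_dvd_right _ _)

theorem associated_gcd_of_lcm {ι α : Type*} [CommMonoidWithZero α]
    [NormalizedGCDMonoid α] {s : Finset ι} {G g : ι → α} {c L L' : α}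
    (hL : ∀ r, L ∣ r ↔ ∀ i ∈ s, G i ∣ r) (hL' : ∀ r, L' ∣ r ↔ ∀ i ∈ s, g i ∣ r)
    (hG : ∀ i ∈ s, g i ∣ G i) (hc : ∀ i ∈ s, g i ∣ c)
    (hg : ∀ i ∈ s, ∀ r, r ∣ G i → r ∣ c → r ∣ g i) : Associated L' (gcd L c) := by
  refine associated_of_dvd_dvd ((hL' _).2 fun i hi => dvd_gcd ?_ (hc i hi)) ?_
  · exact (hG i hi).trans ((hL L).1 dvd_rfl i hi)
  · have h1 : L ∣ s.lcm G := (hL _).2 fun i hi => Finset.dvd_lcm hi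
    refine (dvd_finset_lcm_gcd_of_dvd_lcm s _ ((gcd_dvd_left _ c).trans h1)).trans
      (Finset.lcm_dvd fun i hi => ?_)
    exact (hg i hi _ (gcd_dvd_left _ _) ((gcd_dvd_right _ _).trans (gcd_dvd_right _ _))).trans
      ((hL' L').1 dvd_rfl i hi)

/-- The Chinese remainder theorem for moduli that need not be coprime. -/
theorem exists_sub_dvd_of_pairwise_gcd_dvd {ι R : Type*} [CommRing R] [IsDomain R]
    [IsPrincipalIdealRing R] [NormalizedGCDMonoid R] (s : Finset ι) (G r : ι → R)
    (h : ∀ i ∈ s, ∀ j ∈ s, gcd (G i) (G j) ∣ r i - r j) : ∃ x, ∀ i ∈ s, G i ∣ x - r i := by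
  classical
  induction s using Finset.induction_on with
  | empty => exact ⟨0, by simp⟩
  | insert k s hk ih =>
    obtain ⟨x, hx⟩ := ih fun i hi j hj =>
      h i (Finset.mem_insert_of_mem hi) j (Finset.mem_insert_of_mem hj)
    -- By distributivity it is enough to test the part of this gcd shared with each `G i`, where `r
    -- k ≡ r i ≡ x`.
    have h1 : gcd (s.lcm G) (G k) ∣ r k - x := by
      refine (dvd_finset_lcm_gcd_of_dvd_lcm s G (gcd_dvd_left _ (G k))).trans ?_
      refine Finset.lcm_dvd fun i hi => ?_
      have h2 : gcd (G i) (gcd (s.lcm G) (G k)) ∣ gcd (G i) (G k) :=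
        gcd_dvd_gcd dvd_rfl (gcd_dvd_right _ _)
      have h3 := h k (Finset.mem_insert_self _ _) i (Finset.mem_insert_of_mem hi)
      have h4 : r k - x = (r k - r i) - (x - r i) := by ring
      rw [h4]
      exact dvd_sub (h2.trans ((gcd_comm' _ _).dvd.trans h3)) ((gcd_dvd_left _ _).trans (hx i hi))
    obtain ⟨u, v, huv⟩ := (gcd_dvd_iff_exists _ _).1 h1
    refine ⟨x + s.lcm G * u, fun i hi => ?_⟩
    rcases Finset.mem_insert.1 hi with rfl | hi
    · refine ⟨-v, ?_⟩
      linear_combination -huv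
    · rw [add_sub_right_comm]
      exact dvd_add (hx i hi) ((Finset.dvd_lcm hi).mul_right u)

end GCD

/-! ### The degree of the lcm of the `X ^ d i - 1`. -/

section XPowSubOne

open Polynomial

variable {F : Type*} [Field F]

/-- Both hypotheses say that an exponent is a multiple of the order of `x` modulo `r`. -/
theorem dvd_pow_gcd_sub_one {R : Type*} [CommRing R] {r x : R} {a b : ℕ} (ha : r ∣ x ^ a - 1)
    (hb : r ∣ x ^ b - 1) : r ∣ x ^ Nat.gcd a b - 1 := by
  have key : ∀ n, r ∣ x ^ n - 1 ↔ orderOf (Ideal.Quotient.mk (Ideal.span {r}) x) ∣ n := by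
    intro n
    rw [orderOf_dvd_iff_pow_eq_one, ← sub_eq_zero, ← map_pow, ← map_one (Ideal.Quotient.mk _),
      ← map_sub, Ideal.Quotient.eq_zero_iff_mem, Ideal.mem_span_singleton]
  rw [key] at *
  exact Nat.dvd_gcd ha hb

theorem pow_sub_one_dvd_pow_sub_one_of_dvd {R : Type*} [CommRing R] (x : R) {a b : ℕ}
    (h : a ∣ b) : x ^ a - 1 ∣ x ^ b - 1 := by
  obtain ⟨c, rfl⟩ := h
  simpa [pow_mul] using sub_dvd_pow_sub_pow (x ^ a) 1 c

theorem X_pow_sub_one_ne_zero {n : ℕ} (hn : 0 < n) : (X ^ n - 1 : F[X]) ≠ 0 :=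
  X_pow_sub_C_ne_zero hn 1

theorem natDegree_X_pow_sub_one (n : ℕ) : (X ^ n - 1 : F[X]).natDegree = n :=
  natDegree_X_pow_sub_C (r := (1 : F))

/-- The alternating sum of the greatest common divisors of the subfamilies of `d`. -/
def alternatingGcdSum {ι : Type*} (s : Finset ι) (d : ι → ℕ) : ℤ :=
  ∑ S ∈ s.powerset, (-1) ^ (S.card + 1) * ((S.gcd d : ℕ) : ℤ)

theorem alternatingGcdSum_insert {ι : Type*} [DecidableEq ι] {s : Finset ι} {k : ι} (hk : k ∉ s)
    (d : ι → ℕ) : alternatingGcdSum (insert k s) d =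
      alternatingGcdSum s d + d k - alternatingGcdSum s fun i => Nat.gcd (d i) (d k) := by
  have hgcd : ∀ S : Finset ι, S.Nonempty →
      (S.gcd fun i => Nat.gcd (d i) (d k)) = (insert k S).gcd d := by
    intro S hS
    obtain ⟨i, hi⟩ := hS
    refine Nat.dvd_antisymm (Finset.dvd_gcd fun j hj => ?_) (Finset.dvd_gcd fun j hj => ?_)
    · rcases Finset.mem_insert.1 hj with rfl | hj
      · exact (Finset.gcd_dvd hi).trans (Nat.gcd_dvd_right _ _)
      · exact (Finset.gcd_dvd hj).trans (Nat.gcd_dvd_left _ _)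
    · exact Nat.dvd_gcd (Finset.gcd_dvd (Finset.mem_insert_of_mem hj))
        (Finset.gcd_dvd (Finset.mem_insert_self _ _))
  rw [alternatingGcdSum, Finset.sum_powerset_insert hk, add_sub_assoc]
  congr 1
  rw [← Finset.add_sum_erase _ _ (Finset.empty_mem_powerset s), alternatingGcdSum,
    ← Finset.add_sum_erase _ _ (Finset.empty_mem_powerset s), Finset.gcd_empty]
  simp only [insert_empty_eq, Finset.card_singleton, Finset.gcd_singleton]
  have : ∑ S ∈ s.powerset.erase ∅, (-1 : ℤ) ^ ((insert k S).card + 1) * ((insert k S).gcd d : ℕ) =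
      -∑ S ∈ s.powerset.erase ∅,
        (-1 : ℤ) ^ (S.card + 1) * ((S.gcd fun i => Nat.gcd (d i) (d k) : ℕ) : ℤ) := by
    rw [← Finset.sum_neg_distrib]
    refine Finset.sum_congr rfl fun S hS => ?_
    obtain ⟨hne, hS⟩ := Finset.mem_erase.1 hS
    rw [hgcd S (Finset.nonempty_iff_ne_empty.2 hne),
      Finset.card_insert_of_notMem fun h => hk (Finset.mem_powerset.1 hS h)]
    ring
  rw [this]
  simp [sub_eq_add_neg]

theorem exists_lcm_X_pow_sub_one {ι : Type*} (s : Finset ι) (d : ι → ℕ) (hd : ∀ i ∈ s, 0 < d i) :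
    ∃ L : F[X], L ≠ 0 ∧ (∀ r, L ∣ r ↔ ∀ i ∈ s, X ^ d i - 1 ∣ r) ∧
      (L.natDegree : ℤ) = alternatingGcdSum s d := by
  classical
  induction s using Finset.induction_on generalizing d with
  | empty => exact ⟨1, one_ne_zero, by simp, by simp [alternatingGcdSum]⟩
  | insert k s hk ih =>
    have hds : ∀ i ∈ s, 0 < d i := fun i hi => hd i (Finset.mem_insert_of_mem hi)
    have hdk := hd k (Finset.mem_insert_self _ _)
    obtain ⟨L, hL0, hL, hLd⟩ := ih d hds
    -- By distributivity `gcd L (X ^ d k - 1)` is the lcm of the `X ^ gcd (d i) (d k) - 1`. So `deg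
    -- lcm + deg gcd = deg L + d k` reproduces the recursion of `alternatingGcdSum`.
    obtain ⟨L', hL0', hL', hLd'⟩ := ih (fun i => Nat.gcd (d i) (d k)) fun i hi =>
      Nat.gcd_pos_of_pos_left _ (hds i hi)
    have hG : (X ^ d k - 1 : F[X]) ≠ 0 := X_pow_sub_one_ne_zero hdk
    have hassoc : Associated L' (gcd L (X ^ d k - 1)) :=
      associated_gcd_of_lcm hL hL'
        (fun i _ => pow_sub_one_dvd_pow_sub_one_of_dvd X (Nat.gcd_dvd_left _ _))
        (fun i _ => pow_sub_one_dvd_pow_sub_one_of_dvd X (Nat.gcd_dvd_right _ _))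
        fun i _ r h₁ h₂ => dvd_pow_gcd_sub_one h₁ h₂
    have hM0 : lcm L (X ^ d k - 1) ≠ 0 := fun h => by
      rcases (lcm_eq_zero_iff _ _).1 h with h | h
      exacts [hL0 h, hG h]
    refine ⟨lcm L (X ^ d k - 1), hM0, fun r => ?_, ?_⟩
    · rw [lcm_dvd_iff, hL, Finset.forall_mem_insert, and_comm]
    · have h1 := natDegree_eq_of_degree_eq
        (degree_eq_degree_of_associated (gcd_mul_lcm L (X ^ d k - 1)))
      have h2 := natDegree_eq_of_degree_eq (degree_eq_degree_of_associated hassoc)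
      rw [natDegree_mul (hassoc.ne_zero_iff.1 hL0') hM0, natDegree_mul hL0 hG,
        natDegree_X_pow_sub_one, ← h2] at h1
      rw [alternatingGcdSum_insert hk]
      omega

theorem lam_eq_alternatingGcdSum {k : ℕ} (hk : 1 < k) (d : Fin k → ℕ) :
    lam d = alternatingGcdSum Finset.univ d := by
  have h1 : ∀ r, ∑ S ∈ Finset.powersetCard r (Finset.univ : Finset (Fin k)),
      (-1 : ℤ) ^ (S.card + 1) * ((S.gcd d : ℕ) : ℤ) =
      (-1 : ℤ) ^ (r + 1) * ∑ S ∈ Finset.powersetCard r (Finset.univ : Finset (Fin k)),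
        ((S.gcd d : ℕ) : ℤ) := by
    intro r
    rw [Finset.mul_sum]
    refine Finset.sum_congr rfl fun S hS => ?_
    rw [(Finset.mem_powersetCard.1 hS).2]
  -- The term `r = 0` vanishes since the gcd of the empty set is 0; the term `r = 1` is the sum of
  -- the `d i`.
  rw [alternatingGcdSum, Finset.sum_powerset, Finset.card_univ, Fintype.card_fin,
    Finset.range_eq_Ico, Finset.sum_eq_sum_Ico_succ_bot (by omega),
    Finset.sum_eq_sum_Ico_succ_bot (by omega), lam]
  simp only [h1]
  simp [Finset.powersetCard_one, Finset.Ico_add_one_right_eq_Icc]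

end XPowSubOne

/-! ### Trace polynomials. -/

section TracePoly

open Polynomial

variable {F : Type*} [Field F]

variable (F) in
/-- The polynomial `(X ^ n - 1) / (X ^ d - 1)`, for `d ∣ n`. -/
noncomputable def tracePoly (n d : ℕ) : F[X] := ∑ i ∈ Finset.range (n / d), X ^ (i * d)

theorem tracePoly_mul {n d : ℕ} (h : d ∣ n) : tracePoly F n d * (X ^ d - 1) = X ^ n - 1 := by
  have : tracePoly F n d = ∑ i ∈ Finset.range (n / d), (X ^ d) ^ i :=
    Finset.sum_congr rfl fun i _ => by rw [← pow_mul, mul_comm]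
  rw [this, geom_sum_mul, ← pow_mul, Nat.mul_div_cancel' h]

theorem tracePoly_mul_tracePoly {n d g : ℕ} (hg : 0 < g) (hgd : g ∣ d) (hdn : d ∣ n) :
    tracePoly F d g * tracePoly F n d = tracePoly F n g := by
  apply mul_right_cancel₀ (X_pow_sub_one_ne_zero (F := F) hg)
  rw [mul_right_comm, tracePoly_mul hgd, mul_comm, tracePoly_mul hdn,
    tracePoly_mul (hgd.trans hdn)]

theorem eq_zero_of_X_pow_sub_one_dvd_of_mem_degreeLT {m : ℕ} {r : F[X]} (hr : r ∈ degreeLT F m)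
    (h : X ^ m - 1 ∣ r) : r = 0 := by
  by_contra h0
  rcases m.eq_zero_or_pos with rfl | hm
  · simp at h
    exact h0 h
  have h1 := degree_le_of_dvd h h0
  rw [mem_degreeLT] at hr
  have h2 : (X ^ m - 1 : F[X]).degree = m := degree_X_pow_sub_C hm 1
  rw [h2] at h1
  exact hr.not_ge h1

theorem finrank_degreeLT (n : ℕ) : Module.finrank F (degreeLT F n) = n := by
  rw [(degreeLTEquiv F n).finrank_eq, Module.finrank_fin_fun]

end TracePoly

/-! ### The Frobenius module and normal elements. -/

section Frobenius

open Polynomial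

variable (F : Type*) {K : Type*} [Field F] [Fintype F] [Field K] [Algebra F K]

/-- The action of a polynomial on `K`, with `X` acting as the Frobenius `x ↦ x ^ q`. -/
noncomputable def frobAction : F[X] →ₐ[F] Module.End F K :=
  aeval (FiniteField.frobeniusAlgHom F K).toLinearMap

/-- `K` as a module over `F[X]`, with `X` acting as the Frobenius. -/
@[reducible] noncomputable def frobModule : Module F[X] K :=
  Module.compHom K (frobAction F (K := K)).toRingHom

variable {F}

theorem frobAction_mul_apply (f g : F[X]) (x : K) :
    frobAction F (f * g) x = frobAction F f (frobAction F g x) := by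
  rw [map_mul, Module.End.mul_apply]

theorem frobAction_X_pow (n : ℕ) (x : K) :
    frobAction F (X ^ n) x = x ^ (Nat.card F ^ n) := by
  rw [frobAction, aeval_X_pow, Module.End.coe_pow, Nat.card_eq_fintype_card]
  induction n with
  | zero => simp
  | succ n ih =>
    rw [Function.iterate_succ_apply', ih, pow_succ, pow_mul]
    rfl

theorem frobAction_X_pow_sub_one_eq_zero_iff (n : ℕ) (x : K) :
    frobAction F (X ^ n - 1) x = 0 ↔ x ^ (Nat.card F ^ n) = x := by
  rw [map_sub, map_one, LinearMap.sub_apply, frobAction_X_pow, Module.End.one_apply, sub_eq_zero]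

theorem frobAction_sum {ι : Type*} (s : Finset ι) (c : ι → F) (n : ι → ℕ) (x : K) :
    frobAction F (∑ i ∈ s, C (c i) * X ^ n i) x = ∑ i ∈ s, c i • x ^ (Nat.card F ^ n i) := by
  rw [map_sum, LinearMap.sum_apply]
  refine Finset.sum_congr rfl fun i _ => ?_
  rw [← smul_eq_C_mul, map_smul, LinearMap.smul_apply, frobAction_X_pow]

theorem tr_eq_frobAction (n d : ℕ) (x : K) : tr F n d x = frobAction F (tracePoly F n d) x := by
  have := frobAction_sum (Finset.range (n / d)) (fun _ => (1 : F)) (fun i => i * d) x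
  simpa [tr, tracePoly] using this.symm

section Finite

variable [Finite K]

theorem frobAction_of_X_pow_finrank_sub_one_dvd {r : F[X]}
    (h : X ^ Module.finrank F K - 1 ∣ r) (x : K) : frobAction F r x = 0 := by
  obtain ⟨s, rfl⟩ := h
  rw [mul_comm, frobAction_mul_apply, ← FiniteField.minpoly_frobeniusAlgHom, frobAction,
    minpoly.aeval, LinearMap.zero_apply, map_zero]

variable (F K) in
-- The normal basis theorem in module form: over a principal ideal domain some element has the
-- annihilator of the whole module, here generated by the minimal polynomial `X ^ m - 1` of the
-- Frobenius.
theorem exists_annihilator_eq :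
    ∃ β : K, ∀ r : F[X], frobAction F r β = 0 → X ^ Module.finrank F K - 1 ∣ r := by
  obtain ⟨x, hx⟩ := Module.exists_ker_toSpanSingleton_eq_annihilator F[X]
    (Module.AEval' (FiniteField.frobeniusAlgHom F K).toLinearMap)
  obtain ⟨β, rfl⟩ := (Module.AEval'.of _).surjective x
  refine ⟨β, fun r hr => ?_⟩
  rw [← span_minpoly_eq_annihilator, FiniteField.minpoly_frobeniusAlgHom] at hx
  rw [← Ideal.mem_span_singleton, ← hx, LinearMap.mem_ker, LinearMap.toSpanSingleton_apply,
    ← Module.AEval.of_aeval_smul]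
  change Module.AEval'.of _ (frobAction F r β) = 0
  rw [hr, map_zero]

/-- The linear map `r ↦ r • s • β` on polynomials `r` of degree less than `n`. -/
noncomputable def evalDegreeLT (n : ℕ) (s : F[X]) (β : K) : degreeLT F n →ₗ[F] K where
  toFun r := frobAction F (r * s) β
  map_add' a b := by simp [add_mul]
  map_smul' c a := by simp

theorem evalDegreeLT_injective {β : K}
    (hβ : ∀ r : F[X], frobAction F r β = 0 → X ^ Module.finrank F K - 1 ∣ r) {s t : F[X]}
    (hst : s * t = X ^ Module.finrank F K - 1) {n : ℕ} (hn : n ≤ t.natDegree) :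
    Function.Injective (evalDegreeLT n s β) := by
  rw [← LinearMap.ker_eq_bot, LinearMap.ker_eq_bot']
  rintro ⟨r, hr⟩ h
  have h1 : X ^ Module.finrank F K - 1 ∣ r * s := hβ _ h
  have h0 : (X ^ Module.finrank F K - 1 : F[X]) ≠ 0 := X_pow_sub_one_ne_zero Module.finrank_pos
  have hs : s ≠ 0 := fun h => h0 (by rw [← hst, h, zero_mul])
  rw [← hst, mul_comm r, mul_dvd_mul_iff_left hs] at h1
  rw [Submodule.mk_eq_zero]
  by_contra hr0
  have h2 := natDegree_le_of_dvd h1 hr0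
  have h3 := (natDegree_lt_iff_degree_lt hr0).2 (mem_degreeLT.1 hr)
  omega

theorem exists_frobAction_eq {β : K}
    (hβ : ∀ r : F[X], frobAction F r β = 0 → X ^ Module.finrank F K - 1 ∣ r) (x : K) :
    ∃ r : F[X], frobAction F r β = x := by
  have h1 := evalDegreeLT_injective hβ (one_mul _) (natDegree_X_pow_sub_one _).ge
  obtain ⟨r, hr⟩ := (LinearMap.injective_iff_surjective_of_finrank_eq_finrank
    (finrank_degreeLT (F := F) (Module.finrank F K))).1 h1 x
  exact ⟨r * 1, hr⟩

/-- If `r` kills `α`, so does its gcd with `X ^ m - 1`. Were the cofactor not a unit, an irreducible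
factor `P` of it would give a multiple `Q` of this gcd that kills `α`. -/
theorem dvd_of_frobAction_eq_zero {α : K}
    (h : ∀ P Q : F[X], P.Monic → Irreducible P → P * Q = X ^ Module.finrank F K - 1 →
      frobAction F Q α ≠ 0) (r : F[X]) (hr : frobAction F r α = 0) :
    X ^ Module.finrank F K - 1 ∣ r := by
  classical
  have h0 : (X ^ Module.finrank F K - 1 : F[X]) ≠ 0 := X_pow_sub_one_ne_zero Module.finrank_pos
  obtain ⟨u, v, huv⟩ := (gcd_dvd_iff_exists r (X ^ Module.finrank F K - 1)).1 dvd_rfl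
  obtain ⟨t, ht⟩ := gcd_dvd_right r (X ^ Module.finrank F K - 1)
  have hg : frobAction F (gcd r (X ^ Module.finrank F K - 1)) α = 0 := by
    rw [huv, map_add, LinearMap.add_apply, mul_comm r, frobAction_mul_apply, hr, map_zero,
      frobAction_of_X_pow_finrank_sub_one_dvd (Dvd.intro _ rfl), add_zero]
  by_cases hu : IsUnit t
  · rw [ht]
    exact ((associated_mul_unit_left _ _ hu).dvd).trans (gcd_dvd_left _ _)
  · have ht0 : t ≠ 0 := by
      rintro rfl
      exact h0 (by rw [ht, mul_zero])
    obtain ⟨P, hPm, hP, s, hs⟩ := exists_monic_irreducible_factor t hu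
    refine absurd ?_ (h P (s * gcd r (X ^ Module.finrank F K - 1)) hPm hP ?_)
    · rw [frobAction_mul_apply, hg, map_zero]
    · conv_rhs => rw [ht, hs]
      ring

theorem isNormalElement_of_dvd {α : K}
    (h : ∀ r : F[X], frobAction F r α = 0 → X ^ Module.finrank F K - 1 ∣ r) :
    IsNormalElement F α := by
  have hli : LinearIndependent F
      (fun i : Fin (Module.finrank F K) => α ^ (Nat.card F ^ (i : ℕ))) := by
    rw [Fintype.linearIndependent_iff]
    intro c hc
    have h1 := frobAction_sum Finset.univ c (fun i => (i : ℕ)) α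
    rw [hc] at h1
    have h2 : ∑ i : Fin (Module.finrank F K), C (c i) * X ^ (i : ℕ) = 0 := by
      refine eq_zero_of_X_pow_sub_one_dvd_of_mem_degreeLT ?_ (h _ h1)
      refine Submodule.sum_mem _ fun i _ => mem_degreeLT.2 ?_
      exact (degree_C_mul_X_pow_le _ _).trans_lt (by exact_mod_cast i.2)
    intro i
    have h3 := congrArg (fun f => f.coeff (i : ℕ)) h2
    simpa [finsetSum_coeff, coeff_C_mul, coeff_X_pow, Fin.val_inj] using h3
  exact ⟨hli, hli.span_eq_top_of_card_eq_finrank' (Fintype.card_fin _)⟩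

/-- The elements `r * tracePoly F m d` applied to `β`, with `deg r < d`, are distinct and fixed by
the `d`-th Frobenius power. This inequality suffices to read coefficients in
`IsNormalElement.frobAction_ne_zero`. -/
theorem le_finrank_subfieldOfDegree {d : ℕ} (hd : d ∣ Module.finrank F K) :
    d ≤ Module.finrank F (subfieldOfDegree F K d) := by
  obtain ⟨β, hβ⟩ := exists_annihilator_eq F K
  have hinj := evalDegreeLT_injective hβ (tracePoly_mul hd) (natDegree_X_pow_sub_one d).ge
  have hmem : ∀ r, evalDegreeLT d (tracePoly F (Module.finrank F K) d) β r ∈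
      Subalgebra.toSubmodule (subfieldOfDegree F K d).toSubalgebra := by
    intro r
    refine (frobAction_X_pow_sub_one_eq_zero_iff _ _).1 ?_
    change frobAction F _ (frobAction F (r * tracePoly F (Module.finrank F K) d) β) = 0
    rw [← frobAction_mul_apply]
    refine frobAction_of_X_pow_finrank_sub_one_dvd ⟨r, ?_⟩ β
    rw [← tracePoly_mul hd]
    ring
  have := LinearMap.finrank_le_finrank_of_injective
    (f := (evalDegreeLT d _ β).codRestrict _ hmem) fun a b hab => hinj (congrArg Subtype.val hab)
  rwa [finrank_degreeLT] at this

theorem IsNormalElement.frobAction_ne_zero {d : ℕ} (hd : d ∣ Module.finrank F K)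
    {a : subfieldOfDegree F K d} (ha : IsNormalElement F a) {r : F[X]} (hr : r ≠ 0)
    (hrd : r.natDegree < d) : frobAction F r (a : K) ≠ 0 := by
  intro h
  have hn := hrd.trans_le (le_finrank_subfieldOfDegree hd)
  set n := Module.finrank F (subfieldOfDegree F K d)
  have h1 := Fintype.linearIndependent_iff.1 ha.1 (fun i => r.coeff i) ?_
  · exact hr (leadingCoeff_eq_zero.1 (h1 ⟨_, hn⟩))
  · apply Subtype.val_injective
    have h2 := frobAction_sum (Finset.range n) r.coeff id (a : K)
    simp only [id] at h2
    simp_rw [← r.as_sum_range_C_mul_X_pow' hn, h] at h2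
    rw [Finset.sum_range] at h2
    push_cast
    exact h2.symm

end Finite

end Frobenius

/-! ### Fibres of the trace conditions, and counting squarefree divisors. -/

section TracePreimages

open Polynomial

variable {F K : Type*} [Field F] [Fintype F] [Field K] [Finite K] [Algebra F K]

/-- Write `a i` as `tracePoly F m (d i) * r i` applied to a normal `β`. Admissibility becomes `r i ≡
r j` modulo `X ^ gcd (d i) (d j) - 1`, and a common solution `x` of `x ≡ r i` modulo `X ^ d i - 1`
gives `α`. -/
theorem exists_tr_eq {k : ℕ} {d : Fin k → ℕ} (hd : ∀ i, d i ∣ Module.finrank F K)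
    (hpos : ∀ i, 0 < d i) {a : ∀ i, subfieldOfDegree F K (d i)} (ha : IsAdmissible d a) :
    ∃ α : K, ∀ i, tr F (Module.finrank F K) (d i) α = a i := by
  classical
  set m := Module.finrank F K with hm
  have hm0 : (X ^ m - 1 : F[X]) ≠ 0 := X_pow_sub_one_ne_zero Module.finrank_pos
  obtain ⟨β, hβ⟩ := exists_annihilator_eq F K
  have h1 : ∀ i, ∃ r : F[X], frobAction F (tracePoly F m (d i) * r) β = a i := by
    intro i
    obtain ⟨s, hs⟩ := exists_frobAction_eq hβ (a i : K)
    have h2 : frobAction F ((X ^ d i - 1) * s) β = 0 := by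
      rw [frobAction_mul_apply, hs, frobAction_X_pow_sub_one_eq_zero_iff]
      exact (a i).2
    have h3 := hβ _ h2
    rw [← hm, ← tracePoly_mul (hd i), mul_comm, mul_dvd_mul_iff_left
      (X_pow_sub_one_ne_zero (hpos i))] at h3
    obtain ⟨r, rfl⟩ := h3
    exact ⟨r, hs⟩
  choose r hr using h1
  have hlt : ∀ i j, i < j → (X ^ Nat.gcd (d i) (d j) - 1 : F[X]) ∣ r i - r j := by
    intro i j hij
    have h2 := ha i j hij
    have hg := Nat.gcd_pos_of_pos_left (d j) (hpos i)
    rw [tr_eq_frobAction, tr_eq_frobAction, ← hr, ← hr, ← frobAction_mul_apply,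
      ← frobAction_mul_apply, ← mul_assoc, ← mul_assoc,
      tracePoly_mul_tracePoly hg (Nat.gcd_dvd_left _ _) (hd i),
      tracePoly_mul_tracePoly hg (Nat.gcd_dvd_right _ _) (hd j), ← sub_eq_zero,
      ← LinearMap.sub_apply, ← map_sub, ← mul_sub] at h2
    have h3 := hβ _ h2
    have h4 := tracePoly_mul (F := F) ((Nat.gcd_dvd_left (d i) (d j)).trans (hd i))
    rw [← h4] at hm0 h3
    exact (mul_dvd_mul_iff_left (left_ne_zero_of_mul hm0)).1 h3
  have hgcd : ∀ i j, gcd (X ^ d i - 1 : F[X]) (X ^ d j - 1) ∣ r i - r j := by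
    intro i j
    have h2 : gcd (X ^ d i - 1 : F[X]) (X ^ d j - 1) ∣ X ^ Nat.gcd (d i) (d j) - 1 :=
      dvd_pow_gcd_sub_one (gcd_dvd_left _ _) (gcd_dvd_right _ _)
    rcases lt_trichotomy i j with h | rfl | h
    · exact h2.trans (hlt i j h)
    · simp
    · rw [Nat.gcd_comm] at h2
      exact (dvd_sub_comm).1 (h2.trans (hlt j i h))
  obtain ⟨x, hx⟩ := exists_sub_dvd_of_pairwise_gcd_dvd Finset.univ (fun i => (X ^ d i - 1 : F[X])) r
    fun i _ j _ => hgcd i j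
  refine ⟨frobAction F x β, fun i => ?_⟩
  rw [tr_eq_frobAction, ← frobAction_mul_apply, ← hr i, ← sub_eq_zero, ← LinearMap.sub_apply,
    ← map_sub, ← mul_sub]
  refine frobAction_of_X_pow_finrank_sub_one_dvd ?_ β
  rw [← hm, ← tracePoly_mul (hd i)]
  exact mul_dvd_mul_left _ (hx i (Finset.mem_univ i))

theorem pow_le_card_tr_eq {k : ℕ} {d : Fin k → ℕ} (hd : ∀ i, d i ∣ Module.finrank F K)
    (hpos : ∀ i, 0 < d i) {a : ∀ i, subfieldOfDegree F K (d i)} (ha : IsAdmissible d a)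
    {L : F[X]} (hL : ∀ i, X ^ d i - 1 ∣ L) (hLm : L ∣ X ^ Module.finrank F K - 1) :
    Nat.card F ^ (Module.finrank F K - L.natDegree) ≤
      Nat.card {α : K // ∀ i, tr F (Module.finrank F K) (d i) α = a i} := by
  obtain ⟨α, hα⟩ := exists_tr_eq hd hpos ha
  obtain ⟨β, hβ⟩ := exists_annihilator_eq F K
  obtain ⟨t, ht⟩ := hLm
  have hm0 : (X ^ Module.finrank F K - 1 : F[X]) ≠ 0 := X_pow_sub_one_ne_zero Module.finrank_pos
  have ht' : Module.finrank F K - L.natDegree = t.natDegree := by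
    have h := natDegree_X_pow_sub_one (F := F) (Module.finrank F K)
    rw [ht, natDegree_mul (left_ne_zero_of_mul (ht ▸ hm0)) (right_ne_zero_of_mul (ht ▸ hm0))] at h
    omega
  rw [ht']
  have hinj := evalDegreeLT_injective hβ ht.symm le_rfl
  have hcard : Nat.card (degreeLT F t.natDegree) = Nat.card F ^ t.natDegree := by
    rw [Module.natCard_eq_pow_finrank (K := F), finrank_degreeLT]
  rw [← hcard]
  -- Multiples of `L` have all traces zero, so adding them to one solution stays in the fibre.
  refine Nat.card_le_card_of_injective
    (fun r => ⟨α + evalDegreeLT t.natDegree L β r, fun i => ?_⟩) fun r s h => ?_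
  · rw [tr_eq_frobAction, map_add, ← tr_eq_frobAction, hα]
    change _ + frobAction F _ (frobAction F (r * L) β) = _
    rw [← frobAction_mul_apply, frobAction_of_X_pow_finrank_sub_one_dvd, add_zero]
    rw [← tracePoly_mul (hd i)]
    exact mul_dvd_mul_left _ ((hL i).mul_left _)
  · exact hinj (add_left_cancel (congrArg Subtype.val h))

theorem two_pow_card_le_polyW {f : F[X]} (hf : f ≠ 0) {S : Finset F[X]}
    (hm : ∀ P ∈ S, P.Monic) (hi : ∀ P ∈ S, Irreducible P) (hS : ∀ P ∈ S, P ∣ f) :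
    2 ^ S.card ≤ polyW f := by
  classical
  have hcop : ∀ P ∈ S, ∀ Q ∈ S, P ≠ Q → IsCoprime P Q := fun P hP Q hQ hne =>
    (hi P hP).coprime_iff_not_dvd.2 fun h => hne
      (eq_of_monic_of_associated (hm P hP) (hm Q hQ) ((hi P hP).associated_of_dvd (hi Q hQ) h))
  have hmem : ∀ T ⊆ S, ∀ P ∈ S, P ∣ ∏ Q ∈ T, Q → P ∈ T := by
    intro T hT P hP h
    obtain ⟨Q, hQ, hPQ⟩ := (Prime.dvd_finsetProd_iff (hi P hP).prime _).1 h
    have := eq_of_monic_of_associated (hm P hP) (hm Q (hT hQ))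
      ((hi P hP).associated_of_dvd (hi Q (hT hQ)) hPQ)
    exact this ▸ hQ
  have hinj : Set.InjOn (fun T : Finset F[X] => ∏ Q ∈ T, Q) (S.powerset : Set (Finset F[X])) := by
    intro T hT T' hT' h
    have hT := Finset.mem_powerset.1 hT
    have hT' := Finset.mem_powerset.1 hT'
    simp only at h
    ext P
    constructor
    · exact fun hP => hmem T' hT' P (hT hP) (h ▸ Finset.dvd_prod_of_mem _ hP)
    · exact fun hP => hmem T hT P (hT' hP) (h ▸ Finset.dvd_prod_of_mem _ hP)
  -- Finiteness matters: `Set.ncard` of an infinite set would be 0.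
  have hfin : {g : F[X] | g.Monic ∧ Squarefree g ∧ g ∣ f}.Finite := by
    have : Finite (degreeLT F (f.natDegree + 1)) := Module.finite_of_finite F
    refine (Set.toFinite (degreeLT F (f.natDegree + 1) : Set F[X])).subset fun g hg => ?_
    refine mem_degreeLT.2 (degree_lt_iff_coeff_zero _ _ |>.2 fun n hn => ?_)
    exact coeff_eq_zero_of_natDegree_lt
      ((natDegree_le_of_dvd hg.2.2 hf).trans_lt (Nat.lt_of_succ_le hn))
  rw [← Finset.card_powerset, ← Finset.card_image_of_injOn hinj, ← Set.ncard_coe_finset, polyW]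
  refine Set.ncard_le_ncard (fun g hg => ?_) hfin
  obtain ⟨T, hT, rfl⟩ := Finset.mem_image.1 (Finset.mem_coe.1 hg)
  have hT := Finset.mem_powerset.1 hT
  refine ⟨monic_prod_of_monic _ _ fun P hP => hm P (hT hP),
    Finset.squarefree_prod_of_pairwise_isCoprime (fun P hP Q hQ hne =>
      (hcop P (hT hP) Q (hT hQ) hne).isRelPrime) fun P hP => (hi P (hT hP)).squarefree,
    Finset.prod_dvd_of_coprime (fun P hP Q hQ hne => hcop P (hT hP) Q (hT hQ) hne)
      fun P hP => hS P (hT hP)⟩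

end TracePreimages

theorem two_pow_card_primeFactors_le_natW {n : ℕ} (hn : n ≠ 0) :
    2 ^ n.primeFactors.card ≤ natW n := by
  have h := Nat.sum_divisors_filter_squarefree hn (f := fun _ => 1)
  have h2 : {t : ℕ | t ∣ n ∧ Squarefree t} = (n.divisors.filter Squarefree : Finset ℕ) := by
    ext t
    simp [hn]
  rw [← Finset.card_eq_sum_ones, ← Finset.card_eq_sum_ones, Finset.card_powerset] at h
  rw [natW, h2, Set.ncard_coe_finset, h, Nat.factors_eq, Nat.primeFactors]
  rfl

/-! ### Combining both sieves with the size of the fibre. -/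

section Existence

open Polynomial

variable {F K : Type*} [Field F] [Fintype F] [Field K] [Fintype K] [Algebra F K]

theorem exists_generator_of_lt_card_tr_eq {k : ℕ} {d : Fin k → ℕ} (i₀ : Fin k)
    (hd : ∀ i, d i ∣ Module.finrank F K) {a : Fin k → K} (ha : a i₀ ≠ 0)
    {S : Finset F[X]} (hm : ∀ P ∈ S, P.Monic) (hi : ∀ P ∈ S, Irreducible P)
    {e : F[X] → F[X]} (he : ∀ P ∈ S, P * e P = X ^ Module.finrank F K - 1)
    (hS : ∀ P ∈ S, ∀ i, ¬ P ∣ X ^ d i - 1) [Fintype Kˣ]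
    (hlt : 2 ^ (Fintype.card Kˣ).primeFactors.card * (2 ^ S.card * √(Fintype.card K)) <
      (Nat.card {α : K // ∀ i, tr F (Module.finrank F K) (d i) α = a i} : ℝ)) :
    ∃ u : Kˣ, Subgroup.zpowers u = ⊤ ∧
      (∀ i, tr F (Module.finrank F K) (d i) (u : K) = a i) ∧
      ∀ P ∈ S, frobAction F (e P) (u : K) ≠ 0 := by
  classical
  let _ : Module F[X] K := frobModule F
  have hsmul : ∀ (f : F[X]) (x : K), f • x = frobAction F f x := fun _ _ => rfl
  set m := Module.finrank F K with hmdef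
  have hm0 : (X ^ m - 1 : F[X]) ≠ 0 := X_pow_sub_one_ne_zero Module.finrank_pos
  let φ : K →+ (Fin k → K) :=
    AddMonoidHom.pi fun i => (frobAction F (tracePoly F m (d i))).toAddMonoidHom
  have hφ : ∀ x, φ x = a ↔ ∀ i, tr F m (d i) x = a i := by
    intro x
    simp only [tr_eq_frobAction]
    exact funext_iff
  let T : K → ℂ := fun x => if φ x = a then 1 else 0
  set κ : ℝ := ∏ P ∈ S, survivingDensity K (e P) with hκ
  have hκ0 : 0 < κ := by
    refine Finset.prod_pos fun P hP => survivingDensity_pos ?_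
    obtain ⟨β, hβ⟩ := exists_annihilator_eq F K
    refine ⟨β, fun h => ?_⟩
    have h1 := hβ _ h
    have he0 : e P ≠ 0 := right_ne_zero_of_mul (he P hP ▸ hm0)
    rw [← hmdef, ← he P hP] at h1
    exact (hi P hP).not_isUnit (isUnit_of_dvd_one
      ((mul_dvd_mul_iff_right he0).1 (by rwa [one_mul])))
  have hsum : ∑ x, T x * siftedIndicator S e x =
      (Nat.card {α : K // ∀ i, tr F m (d i) α = a i} : ℂ) * κ := by
    -- The product of the `X ^ d i - 1` acts into the common kernel of the traces, so it is a period
    -- modulus of `T`, and it is coprime to every `P ∈ S`.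
    have h := sum_mul_siftedIndicator S id e (G := K) ?_ ?_ (r := ∏ i, (X ^ d i - 1)) ?_ (f := T) ?_
    · rw [h, hκ, Complex.ofReal_prod]
      congr 1
      simp only [T, hφ]
      rw [Finset.sum_boole, Nat.card_eq_fintype_card, Fintype.card_subtype]
    · intro P hP Q hQ hne
      exact (hi P hP).coprime_iff_not_dvd.2 fun h => hne
        (eq_of_monic_of_associated (hm P hP) (hm Q hQ) ((hi P hP).associated_of_dvd (hi Q hQ) h))
    · intro P hP x
      rw [smul_smul, hsmul]
      refine frobAction_of_X_pow_finrank_sub_one_dvd ?_ x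
      rw [← hmdef, ← he P hP, id, mul_comm]
    · intro P hP
      refine IsCoprime.prod_left fun i _ => ?_
      exact ((hi P hP).coprime_iff_not_dvd.2 (hS P hP i)).symm
    · intro x y
      have h0 : φ ((∏ i, (X ^ d i - 1 : F[X])) • y) = 0 := by
        funext i
        change frobAction F (tracePoly F m (d i)) (frobAction F _ y) = 0
        rw [← frobAction_mul_apply]
        refine frobAction_of_X_pow_finrank_sub_one_dvd ?_ y
        rw [← hmdef, ← tracePoly_mul (hd i)]
        exact mul_dvd_mul_left _ (Finset.dvd_prod_of_mem _ (Finset.mem_univ i))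
      simp only [T, map_add, h0, add_zero]
  -- This makes the weight vanish at 0, so sums over `K` and `Kˣ` agree.
  have hT0 : φ 0 ≠ a := by
    rw [map_zero]
    exact fun h => ha (congrFun h i₀).symm
  have hT : FourierNormLE T 1 := by
    convert fourierNormLE_fiber φ a
  obtain ⟨u, hu, hne⟩ := exists_generator_of_fourierNormLE
    (hT.mul (fourierNormLE_siftedIndicator S e)) (by positivity)
    (by rw [show T 0 = 0 from if_neg hT0, zero_mul]) (by
      rw [hsum, norm_mul, Complex.norm_natCast, Complex.norm_of_nonneg hκ0.le, ← hκ]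
      have h := mul_lt_mul_of_pos_right hlt hκ0
      calc _ = _ := by ring
        _ < _ := h)
  refine ⟨u, hu, (hφ u).1 ?_, fun P hP h => ?_⟩
  · by_contra h
    exact hne (by rw [show T u = 0 from if_neg h, zero_mul])
  · exact hne (by rw [siftedIndicator_eq_zero_of hP h, mul_zero])

theorem two_pow_mul_lt_card_tr_eq {k : ℕ} (hk : 1 < k) {d : Fin k → ℕ}
    (hd : ∀ i, d i ∣ Module.finrank F K) (hpos : ∀ i, 0 < d i)
    {a : ∀ i, subfieldOfDegree F K (d i)} (ha : IsAdmissible d a) {x y A B : ℕ} (hx : x ≤ A)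
    (hy : y ≤ B)
    (hAB : (A : ℝ) * B ≤ (Nat.card F : ℝ) ^
      ((Module.finrank F K : ℝ) / 2 - (lam d : ℝ) - ((∑ i, d i : ℕ) : ℝ))) :
    (x : ℝ) * (y * √(Fintype.card K)) <
      (Nat.card {α : K // ∀ i, tr F (Module.finrank F K) (d i) α = a i} : ℝ) := by
  obtain ⟨L, hL0, hL, hLd⟩ := exists_lcm_X_pow_sub_one (F := F) Finset.univ d fun i _ => hpos i
  rw [← lam_eq_alternatingGcdSum hk] at hLd
  set m := Module.finrank F K with hm
  have hLm : L ∣ X ^ m - 1 := (hL _).2 fun i _ => pow_sub_one_dvd_pow_sub_one_of_dvd X (hd i)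
  have hm0 : (X ^ m - 1 : F[X]) ≠ 0 := X_pow_sub_one_ne_zero Module.finrank_pos
  have hle : L.natDegree ≤ m := by
    simpa [natDegree_X_pow_sub_one] using natDegree_le_of_dvd hLm hm0
  have hcard := pow_le_card_tr_eq hd hpos ha (fun i => (hL L).1 dvd_rfl i (Finset.mem_univ i)) hLm
  have hq : (1 : ℝ) < Nat.card F := by exact_mod_cast Finite.one_lt_card
  have hq0 : (0 : ℝ) < Nat.card F := one_pos.trans hq
  have hK : √(Fintype.card K : ℝ) = (Nat.card F : ℝ) ^ ((m : ℝ) / 2) := by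
    rw [← Nat.card_eq_fintype_card, Module.natCard_eq_pow_finrank (K := F) (V := K), ← hm,
      Real.sqrt_eq_rpow, Nat.cast_pow, ← Real.rpow_natCast, ← Real.rpow_mul hq0.le]
    congr 1
    ring
  have hlam : (lam d : ℝ) = (L.natDegree : ℝ) := by
    rw [← hLd]
    simp
  -- Positivity of `D` turns the weak inequality `hAB` into a strict one.
  have hD : (0 : ℝ) < ((∑ i, d i : ℕ) : ℝ) := by
    have : 0 < ∑ i, d i :=
      Finset.sum_pos (fun i _ => hpos i) ⟨⟨0, by omega⟩, Finset.mem_univ _⟩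
    exact_mod_cast this
  calc (x : ℝ) * (y * √(Fintype.card K)) ≤ A * (B * √(Fintype.card K)) := by gcongr
    _ = A * B * (Nat.card F : ℝ) ^ ((m : ℝ) / 2) := by rw [hK, mul_assoc]
    _ ≤ (Nat.card F : ℝ) ^ ((m : ℝ) / 2 - (lam d : ℝ) - ((∑ i, d i : ℕ) : ℝ)) *
        (Nat.card F : ℝ) ^ ((m : ℝ) / 2) := by gcongr
    _ = (Nat.card F : ℝ) ^ ((m : ℝ) - L.natDegree - ((∑ i, d i : ℕ) : ℝ)) := by
        rw [← Real.rpow_add hq0, hlam]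
        congr 1
        ring
    _ < (Nat.card F : ℝ) ^ ((m : ℝ) - L.natDegree) :=
        Real.rpow_lt_rpow_of_exponent_lt hq (by linarith)
    _ = (Nat.card F : ℝ) ^ (m - L.natDegree : ℕ) := by
        rw [← Real.rpow_natCast, Nat.cast_sub hle]
    _ ≤ _ := by exact_mod_cast hcard

/-- With `R = (X ^ d - 1) / P` one has `Q = R * tracePoly F m d`, so `Q` sends `α` to `R` applied to
`a`. This is nonzero because `deg R < d` and `a` is normal. -/
theorem frobAction_ne_zero_of_dvd_X_pow_sub_one {d : ℕ} (hpos : 0 < d)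
    (hd : d ∣ Module.finrank F K) {a : subfieldOfDegree F K d} (ha : IsNormalElement F a) {α : K}
    (hα : tr F (Module.finrank F K) d α = a) {P Q : F[X]} (hP : Irreducible P)
    (hPQ : P * Q = X ^ Module.finrank F K - 1) (hPd : P ∣ X ^ d - 1) :
    frobAction F Q α ≠ 0 := by
  obtain ⟨R, hR⟩ := hPd
  have h0 : (X ^ d - 1 : F[X]) ≠ 0 := X_pow_sub_one_ne_zero hpos
  have hR0 : R ≠ 0 := right_ne_zero_of_mul (hR ▸ h0)
  have hQ : Q = R * tracePoly F (Module.finrank F K) d := by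
    apply mul_left_cancel₀ hP.ne_zero
    rw [hPQ, ← mul_assoc, ← hR, mul_comm, tracePoly_mul hd]
  rw [hQ, frobAction_mul_apply, ← tr_eq_frobAction, hα]
  refine ha.frobAction_ne_zero hd hR0 ?_
  have h1 := natDegree_X_pow_sub_one (F := F) d
  rw [hR, natDegree_mul hP.ne_zero hR0] at h1
  have h2 := hP.natDegree_pos
  omega

end Existence

end PrescribedTraces

theorem theorem4p1 {F K : Type*} [Field F] [Finite F] [Field K] [Finite K] [Algebra F K]
    (q m k : ℕ) (hq : Nat.card F = q) (hm : Module.finrank F K = m)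
    (hk : 1 < k) (hkm : k < m.divisors.card)
    (d : Fin k → ℕ) (hd : d ∈ PrescribedTraces.divisorTuples k m)
    (a : ∀ i, PrescribedTraces.subfieldOfDegree F K (d i))
    (ha : PrescribedTraces.IsAdmissible d a)
    (han : ∀ i, PrescribedTraces.IsNormalElement F (a i))
    (hW : (PrescribedTraces.natW (q ^ m - 1) : ℝ) *
        (PrescribedTraces.polyW (Polynomial.X ^ m - 1 : Polynomial F) : ℝ) ≤
      (q : ℝ) ^ ((m : ℝ) / 2 - (PrescribedTraces.lam d : ℝ) - ((∑ i, d i : ℕ) : ℝ))) :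
    ∃ α : K, PrescribedTraces.IsPrimitiveElement α ∧ PrescribedTraces.IsNormalElement F α ∧
      ∀ i, PrescribedTraces.tr F m (d i) α = (a i : K) := by
  classical
  open PrescribedTraces Polynomial in
  subst hq hm
  have := Fintype.ofFinite F
  have := Fintype.ofFinite K
  obtain ⟨-, hdvd, -, -⟩ := hd
  have hpos : ∀ i, 0 < d i := fun i => Nat.pos_of_dvd_of_pos (hdvd i) Module.finrank_pos
  set f : F[X] := X ^ Module.finrank F K - 1 with hf
  have hf0 : f ≠ 0 := X_pow_sub_one_ne_zero Module.finrank_pos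
  -- Only factors dividing no `X ^ d i - 1` are sieved; the normality of the `a i` handles the rest.
  let S : Finset F[X] := (UniqueFactorizationMonoid.normalizedFactors f).toFinset.filter
    fun P => ∀ i, ¬ P ∣ X ^ d i - 1
  have hS : ∀ P ∈ S, P.Monic ∧ Irreducible P ∧ P ∣ f ∧ ∀ i, ¬ P ∣ X ^ d i - 1 := by
    intro P hP
    obtain ⟨h1, h2⟩ := Finset.mem_filter.1 hP
    rw [Multiset.mem_toFinset, Polynomial.mem_normalizedFactors_iff hf0] at h1
    exact ⟨h1.2.1, h1.1, h1.2.2, h2⟩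
  have hunits : Fintype.card Kˣ = Nat.card F ^ Module.finrank F K - 1 := by
    rw [Fintype.card_units, ← Nat.card_eq_fintype_card,
      Module.natCard_eq_pow_finrank (K := F) (V := K)]
  have hlt := two_pow_mul_lt_card_tr_eq hk hdvd hpos ha
    (two_pow_card_primeFactors_le_natW (hunits ▸ Fintype.card_ne_zero))
    (two_pow_card_le_polyW hf0 (fun P hP => (hS P hP).1) (fun P hP => (hS P hP).2.1)
      fun P hP => (hS P hP).2.2.1) hW
  rw [← hunits] at hlt
  push_cast at hlt
  have ha0 : (a ⟨0, by omega⟩ : K) ≠ 0 := by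
    have := (han ⟨0, by omega⟩).frobAction_ne_zero (hdvd _) one_ne_zero
      (by rw [natDegree_one]; exact hpos _)
    rwa [map_one] at this
  obtain ⟨u, hu, htr, hne⟩ := exists_generator_of_lt_card_tr_eq ⟨0, by omega⟩ hdvd
    (a := fun i => (a i : K)) ha0 (fun P hP => (hS P hP).1) (fun P hP => (hS P hP).2.1)
    (e := fun P => f / P)
    (fun P hP => EuclideanDomain.mul_div_cancel' (hS P hP).2.1.ne_zero (hS P hP).2.2.1)
    (fun P hP => (hS P hP).2.2.2) hlt
  refine ⟨u, ⟨u, rfl, hu⟩, isNormalElement_of_dvd (dvd_of_frobAction_eq_zero ?_), htr⟩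
  intro P Q hPm hP hPQ
  by_cases h : ∃ i, P ∣ X ^ d i - 1
  · obtain ⟨i, hi⟩ := h
    exact frobAction_ne_zero_of_dvd_X_pow_sub_one (hpos i) (hdvd i) (han i) (htr i) hP hPQ hi
  · push Not at h
    have hPS : P ∈ S := by
      rw [Finset.mem_filter, Multiset.mem_toFinset, Polynomial.mem_normalizedFactors_iff hf0]
      exact ⟨⟨hP, hPm, Dvd.intro _ hPQ⟩, h⟩
    have hQ : f / P = Q := by rw [hf, ← hPQ, mul_div_cancel_left₀ _ hP.ne_zero]
    exact hQ ▸ hne P hPS
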